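/- A Dyck path of semilength $n$ is a lattice path in $\mathbb{Z}^2$ with steps $(1,1)$ and $(1,-1)$ that starts at $(0,0)$, ends at $(2n,0)$, and never goes below the $x$-axis. Its vertices are numbered $0,1,\dots,2n$ from left to right, and the height of a vertex is its $y$-coordinate. **Theorem.** Let $r,d\ge 0$. The limit as $n\to\infty$ of the probability that the $r$-th vertex of a uniformly random Dyck path of semilength $n$ has height $d$ exists. Denote this limit by $p_{r,d}$. For each $r$, the numbers $(p_{r,d})_{d\ge0}$ form a probability distribution, that is, $\sum_{d\ge0}p_{r,d}=1$, and, as formal power series in $x$ and $y$, $$\sum_{r\ge0}\sum_{d\ge0} p_{r,d}\, x^r y^d = \frac{2}{1+y^2-2xy+(1-y^2)\sqrt{1-x^2}},$$ where $\sqrt{1-x^2}$ is the formal power series with constant term $1$ whose square is $1-x^2$. -/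

import Mathlib

open Filter Topology

/-- The height (`y`-coordinate) reached by the lattice path `w` after its first `r` steps, where
the step `U` is `(1, 1)` and the step `D` is `(1, -1)`; for `r ≤ 2 * w.semilength` this is the
height of the `r`-th vertex of `w`, the vertices being numbered from `0`. -/
def dyckVertexHeight (w : DyckWord) (r : ℕ) : ℤ :=
  ((w.toList.take r).count DyckStep.U : ℤ) - ((w.toList.take r).count DyckStep.D : ℤ)

/-- `(r, d)` is one of the `2 * w.semilength + 1` vertices of the Dyck path `w`. -/
def IsDyckVertex (w : DyckWord) (r d : ℕ) : Prop :=
  r ≤ w.toList.length ∧ dyckVertexHeight w r = (d : ℤ)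

/-- The probability that the `r`-th vertex of a uniformly random Dyck path of semilength `n`
exists and has height `d`. -/
noncomputable def dyckHeightProb (n r d : ℕ) : ℝ :=
  (Nat.card {w : DyckWord // w.semilength = n ∧ IsDyckVertex w r d} : ℝ) /
    (Nat.card {w : DyckWord // w.semilength = n} : ℝ)

/-- The formal power series `∑ p r d * x ^ r * y ^ d`, where `x = X 0` and `y = X 1`. -/
def bivariateSeries (p : ℕ → ℕ → ℝ) : MvPowerSeries (Fin 2) ℝ :=
  fun m => p (m 0) (m 1)

/-- The formal power series `√(1 - x ^ 2)`, `x = X 0`: the binomial series `(1 + t) ^ (1 / 2)`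
at `t = - x ^ 2`. -/
noncomputable def sqrtOneSubXSq : MvPowerSeries (Fin 2) ℝ :=
  (PowerSeries.binomialSeries ℝ (1 / 2 : ℝ)).subst (-(MvPowerSeries.X 0) ^ 2 : MvPowerSeries (Fin 2) ℝ)

theorem hasSubst_neg_X_sq :
    PowerSeries.HasSubst (-(MvPowerSeries.X 0) ^ 2 : MvPowerSeries (Fin 2) ℝ) :=
  PowerSeries.HasSubst.of_constantCoeff_zero (by simp)

theorem sqrtOneSubXSq_sq : sqrtOneSubXSq ^ 2 = 1 - (MvPowerSeries.X 0) ^ 2 := by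
  have h : PowerSeries.binomialSeries ℝ (1 / 2 : ℝ) ^ 2 = 1 + PowerSeries.X := by
    rw [sq, ← PowerSeries.binomialSeries_add]
    norm_num
    simpa using PowerSeries.binomialSeries_nat (A := ℝ) (R := ℝ) 1
  have h2 := congrArg (PowerSeries.substAlgHom hasSubst_neg_X_sq) h
  rw [map_pow, map_add, map_one, PowerSeries.substAlgHom_X hasSubst_neg_X_sq,
    PowerSeries.coe_substAlgHom hasSubst_neg_X_sq] at h2
  rw [sqrtOneSubXSq, h2]
  ring

theorem constantCoeff_sqrtOneSubXSq : MvPowerSeries.constantCoeff sqrtOneSubXSq = 1 := by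
  rw [sqrtOneSubXSq, PowerSeries.constantCoeff_subst hasSubst_neg_X_sq,
    finsum_eq_single _ 0]
  · simp
  · intro n hn
    simp [hn]

/-!
The path is cut at its `r`-th vertex. Let `W m a b` (`pathCount`) be the number of nonnegative
paths of length `m` from height `a` to height `b`; it is symmetric in `a` and `b`. A Dyck path of
semilength `n` whose `r`-th vertex has height `d` is a path counted by `W r 0 d` followed by one
counted by `W (2 * n - r) d 0` (`card_semilength_isDyckVertex`), so the probability is
`W r 0 d * W (2 * n - r) d 0 / catalan n`.

*Limit.* The ratio `W (2 * n + d) d 0 / catalan n` tends to `(d + 1) * 2 ^ d`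
(`tendsto_pathCount_div_catalan`). This follows by induction on `d` from the first-step recursion
`W (m + 1) (a + 1) b = W m (a + 2) b + W m a b`, solved for its first summand, and from
`catalan (n + 1) / catalan n → 4`; no closed formula for `W` is needed. Hence
`p r d = W r 0 d * (d + 1) / 2 ^ r` (`tendsto_dyckHeightProb`).

*Total mass.* The function `d ↦ d + 1` on the heights vanishes at `-1`, and the sum of its values
at the two neighbours of `d` is twice its value at `d`. So the sum of `W r 0 d * (d + 1)` over `d`
doubles with every step and equals `2 ^ r` (`hasSum_pathCount_mul`).

*Generating function.* Write `s = √(1 - x ^ 2)`. The series `φ` with `φ * (1 + s - x * y) = 2` has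
coefficients `W r d 0 / 2 ^ r` (`coeff_eq_pathCount_div`): multiplying by the conjugate
`x * y - 1 + s` gives an equation in which `s` occurs only in a term free of `y`, and the
coefficients of positive degree in `y` of that equation are the recursion for `W`. The weights
`d + 1` are produced by the operator `1 + y ∂/∂y`, which maps `φ = 2 / (1 + s - x * y)` to
`2 * (1 + s) / (1 + s - x * y) ^ 2`. Since `(1 + s) * (1 - s) = x ^ 2`, the square
`(1 + s - x * y) ^ 2` is `1 + s` times `1 + y ^ 2 - 2 * x * y + (1 - y ^ 2) * s`
(`bivariateSeries_eq`).
-/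

/-! ### Counting nonnegative paths -/

/-- The number of lattice paths with steps `±1` of length `m` from height `a` to height `b` that
never go below height `0`, defined by recursion on the first step. -/
def pathCount : ℕ → ℕ → ℕ → ℕ
  | 0, a, b => if a = b then 1 else 0
  | m + 1, 0, b => pathCount m 1 b
  | m + 1, a + 1, b => pathCount m (a + 2) b + pathCount m a b

theorem pathCount_zero (a b : ℕ) : pathCount 0 a b = if a = b then 1 else 0 := by
  rw [pathCount]

theorem pathCount_succ_zero (m b : ℕ) : pathCount (m + 1) 0 b = pathCount m 1 b := by
  rw [pathCount]

theorem pathCount_succ_succ (m a b : ℕ) :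
    pathCount (m + 1) (a + 1) b = pathCount m (a + 2) b + pathCount m a b := by
  rw [pathCount]

/-- The recursion of `pathCount` on the last step instead of the first. -/
theorem pathCount_succ_last (m a b : ℕ) :
    pathCount (m + 1) a 0 = pathCount m a 1 ∧
      pathCount (m + 1) a (b + 1) = pathCount m a (b + 2) + pathCount m a b := by
  induction m generalizing a b with
  | zero =>
    rcases a with _ | a <;> simp only [pathCount_succ_zero, pathCount_succ_succ, pathCount_zero] <;>
      constructor <;> split_ifs <;> first | contradiction | omega
  | succ m ih =>
    rcases a with _ | a
    · simpa only [pathCount_succ_zero] using ih 1 b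
    · have h := ih (a + 2) b
      have h' := ih a b
      simp only [pathCount_succ_succ _ a] at h h' ⊢
      omega

theorem pathCount_comm (m a b : ℕ) : pathCount m a b = pathCount m b a := by
  induction m generalizing a b with
  | zero => simp only [pathCount_zero, eq_comm]
  | succ m ih =>
    rcases a with _ | a
    · rw [(pathCount_succ_last m b 0).1, ih b, pathCount_succ_zero]
    · rw [(pathCount_succ_last m b a).2, ih b, ih b, pathCount_succ_succ]

/-- The function `b ↦ b + 1` is harmonic for the simple random walk killed below height `0`. -/
theorem hasSum_pathCount_mul (m a : ℕ) :
    HasSum (fun b : ℕ => (pathCount m a b : ℝ) * (b + 1)) ((a + 1) * 2 ^ m) := by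
  induction m generalizing a with
  | zero =>
    convert hasSum_ite_eq a ((a : ℝ) + 1) using 2 with b
    · rw [pathCount_zero]
      by_cases h : a = b
      · simp [h]
      · simp [h, Ne.symm h]
    · simp
  | succ m ih =>
    rcases a with _ | a
    · simp only [pathCount_succ_zero]
      convert ih 1 using 1
      push_cast; ring
    · convert (ih (a + 2)).add (ih a) using 2 with b
      · rw [pathCount_succ_succ]; push_cast; ring
      · push_cast; ring

/-- The nonnegative paths of length `m` from height `a` to height `b`, as lists of Dyck steps. -/
def dyckPaths : ℕ → ℕ → ℕ → Finset (List DyckStep)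
  | 0, a, b => if a = b then {[]} else ∅
  | m + 1, 0, b => (dyckPaths m 1 b).image (List.cons .U)
  | m + 1, a + 1, b =>
    (dyckPaths m (a + 2) b).image (List.cons .U) ∪ (dyckPaths m a b).image (List.cons .D)

theorem card_dyckPaths (m a b : ℕ) : (dyckPaths m a b).card = pathCount m a b := by
  induction m generalizing a with
  | zero => simp only [dyckPaths, pathCount]; split_ifs <;> simp
  | succ m ih =>
    rcases a with _ | a
    · rw [dyckPaths, Finset.card_image_of_injective _ List.cons_injective, ih]; rfl
    · rw [dyckPaths, Finset.card_union_of_disjoint,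
        Finset.card_image_of_injective _ List.cons_injective,
        Finset.card_image_of_injective _ List.cons_injective, ih, ih]
      · rfl
      · rw [Finset.disjoint_left]
        simp only [Finset.mem_image]
        rintro _ ⟨l, -, rfl⟩ ⟨l', -, h⟩
        simp at h

/-- The recursively defined paths are the lists whose prefixes satisfy the ballot condition. -/
theorem mem_dyckPaths {m a b : ℕ} {l : List DyckStep} :
    l ∈ dyckPaths m a b ↔ l.length = m ∧ a + l.count .U = b + l.count .D ∧
      ∀ i, (l.take i).count .D ≤ a + (l.take i).count .U := by
  induction m generalizing a l with
  | zero =>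
    rw [dyckPaths, List.length_eq_zero_iff]
    split_ifs with h
    · simp only [Finset.mem_singleton]
      refine ⟨?_, fun h => h.1⟩
      rintro rfl
      simp [h]
    · simp only [Finset.notMem_empty, false_iff]
      rintro ⟨rfl, h', -⟩
      simp at h'; exact h h'
  | succ m ih =>
    rcases l with _ | ⟨s, l⟩
    · rcases a with _ | a <;> simp [dyckPaths]
    -- a prefix of `s :: l` is empty or `s` followed by a prefix of `l`
    have hall : (∀ i, ((s :: l).take i).count .D ≤ a + ((s :: l).take i).count .U) ↔
        ∀ i, (s :: l.take i).count .D ≤ a + (s :: l.take i).count .U :=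
      ⟨fun h i => h (i + 1), fun h i => by
        rcases i with _ | i
        · simp
        · exact h i⟩
    rw [hall]
    rcases a with _ | a <;> rcases s with _ | _ <;>
      simp [dyckPaths, ih]
    · intro _
      constructor
      · rintro ⟨h, h'⟩; exact ⟨by omega, fun i => by have := h' i; omega⟩
      · rintro ⟨h, h'⟩; exact ⟨by omega, fun i => by have := h' i; omega⟩
    · intro _ _
      exact ⟨0, by simp⟩
    · intro _
      constructor
      · rintro ⟨h, h'⟩; exact ⟨by omega, fun i => by have := h' i; omega⟩
      · rintro ⟨h, h'⟩; exact ⟨by omega, fun i => by have := h' i; omega⟩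
    · intro _
      constructor
      · rintro ⟨h, h'⟩; exact ⟨by omega, fun i => by have := h' i; omega⟩
      · rintro ⟨h, h'⟩; exact ⟨by omega, fun i => by have := h' i; omega⟩

theorem mem_dyckPaths_zero {n : ℕ} {l : List DyckStep} :
    l ∈ dyckPaths (2 * n) 0 0 ↔ ∃ w : DyckWord, w.toList = l ∧ w.semilength = n := by
  rw [mem_dyckPaths]
  constructor
  · rintro ⟨hl, h, h'⟩
    have hc : l.count .U = l.count .D := by omega
    let w : DyckWord := ⟨l, hc, fun i => by simpa using h' i⟩
    have hw : 2 * w.semilength = l.length := w.two_mul_semilength_eq_length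
    exact ⟨w, rfl, by omega⟩
  · rintro ⟨w, rfl, rfl⟩
    exact ⟨w.two_mul_semilength_eq_length.symm, by rw [w.count_U_eq_count_D],
      fun i => by simpa using w.count_D_le_count_U i⟩

/-- A path whose first part leads from height `a` to height `c` is the concatenation of a path from
`a` to `c` and a path starting at `c`. -/
theorem append_mem_dyckPaths_iff {m k a b c : ℕ} {l₁ l₂ : List DyckStep} (hl : l₁.length = m)
    (hc : a + l₁.count .U = c + l₁.count .D) :
    l₁ ++ l₂ ∈ dyckPaths (m + k) a b ↔ l₁ ∈ dyckPaths m a c ∧ l₂ ∈ dyckPaths k c b := by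
  subst hl
  simp only [mem_dyckPaths, List.length_append, List.count_append, true_and]
  constructor
  · rintro ⟨h1, h2, h3⟩
    refine ⟨⟨hc, fun i => ?_⟩, by omega, by omega, fun i => ?_⟩
    · rcases le_total i l₁.length with h | h
      · simpa [List.take_append_of_le_length h] using h3 i
      · simpa [List.take_of_length_le h] using h3 l₁.length
    · have := h3 (l₁.length + i)
      rw [List.take_length_add_append] at this
      simp only [List.count_append] at this
      omega
  · rintro ⟨⟨-, h1⟩, h2, h3, h4⟩
    refine ⟨by omega, by omega, fun i => ?_⟩
    rcases le_total i l₁.length with h | h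
    · simpa [List.take_append_of_le_length h] using h1 i
    · obtain ⟨j, rfl⟩ := Nat.exists_eq_add_of_le h
      have := h4 j
      rw [List.take_length_add_append]
      simp only [List.count_append]
      omega

/-- Cutting a Dyck path at its `r`-th vertex. -/
theorem card_semilength_isDyckVertex {n r k : ℕ} (hk : r + k = 2 * n) (d : ℕ) :
    Nat.card {w : DyckWord // w.semilength = n ∧ IsDyckVertex w r d} =
      pathCount r 0 d * pathCount k d 0 := by
  rw [← card_dyckPaths, ← card_dyckPaths, ← Finset.card_product, ← Nat.card_eq_finsetCard]
  refine Nat.card_eq_of_bijective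
    (fun w => ⟨(w.1.toList.take r, w.1.toList.drop r), ?_⟩) ⟨?_, ?_⟩
  · obtain ⟨w, hn, hr, hd⟩ := w
    have hmem := mem_dyckPaths_zero.2 ⟨w, rfl, hn⟩
    rw [← hk, ← List.take_append_drop r w.toList, append_mem_dyckPaths_iff (c := d)
      (List.length_take_of_le hr) (by unfold dyckVertexHeight at hd; omega)] at hmem
    simpa using hmem
  · rintro ⟨w, hw⟩ ⟨w', hw'⟩ h
    simp only [Subtype.mk.injEq, Prod.mk.injEq] at h
    rw [Subtype.mk.injEq, DyckWord.ext_iff, ← List.take_append_drop r w.toList, h.1, h.2,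
      List.take_append_drop]
  · rintro ⟨⟨l₁, l₂⟩, h⟩
    rw [Finset.mem_product] at h
    obtain ⟨hl, hc, -⟩ := mem_dyckPaths.1 h.1
    have hmem := (append_mem_dyckPaths_iff hl hc).2 h
    rw [hk] at hmem
    obtain ⟨w, hw, hn⟩ := mem_dyckPaths_zero.1 hmem
    refine ⟨⟨w, hn, ?_, ?_⟩, ?_⟩
    · rw [hw]; simp [hl]
    · unfold dyckVertexHeight
      rw [hw, List.take_left' hl]
      omega
    · simp [hw, List.take_left' hl, List.drop_left' hl]

theorem card_semilength (n : ℕ) :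
    Nat.card {w : DyckWord // w.semilength = n} = catalan n := by
  rw [Nat.card_eq_fintype_card, DyckWord.card_dyckWord_semilength_eq_catalan]

/-! ### Limits of path counts relative to the Catalan numbers -/

theorem pathCount_two_mul_zero_zero (n : ℕ) : pathCount (2 * n) 0 0 = catalan n := by
  rw [← card_semilength, ← one_mul (pathCount _ _ _)]
  have h := card_semilength_isDyckVertex (zero_add (2 * n)) 0
  rw [pathCount_zero, if_pos rfl] at h
  rw [← h]
  simp [IsDyckVertex, dyckVertexHeight]

theorem dyckHeightProb_eq {n r k : ℕ} (hk : r + k = 2 * n) (d : ℕ) :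
    dyckHeightProb n r d = pathCount r 0 d * (pathCount k d 0 / catalan n) := by
  rw [dyckHeightProb, card_semilength_isDyckVertex hk, card_semilength, Nat.cast_mul, mul_div_assoc]

theorem catalan_pos (n : ℕ) : 0 < catalan n :=
  Nat.pos_of_mul_pos_left (by rw [succ_mul_catalan_eq_centralBinom]; exact n.centralBinom_pos)

theorem add_two_mul_catalan_succ (n : ℕ) :
    (n + 2) * catalan (n + 1) = 2 * (2 * n + 1) * catalan n := by
  have h := Nat.succ_mul_centralBinom_succ n
  rw [← succ_mul_catalan_eq_centralBinom, ← succ_mul_catalan_eq_centralBinom n] at h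
  exact Nat.eq_of_mul_eq_mul_left n.succ_pos (by simpa [mul_left_comm] using h)

theorem tendsto_catalan_succ_div :
    Tendsto (fun n : ℕ => (catalan (n + 1) / catalan n : ℝ)) atTop (𝓝 4) := by
  have h : ∀ n : ℕ, (catalan (n + 1) / catalan n : ℝ) = 4 - 6 / ((n : ℝ) + 2) := fun n => by
    have h1 : (catalan n : ℝ) ≠ 0 := by exact_mod_cast (catalan_pos n).ne'
    have h2 : ((n : ℝ) + 2) ≠ 0 := by positivity
    have h3 : ((n : ℝ) + 2) * catalan (n + 1) = 2 * (2 * n + 1) * catalan n := by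
      exact_mod_cast add_two_mul_catalan_succ n
    field_simp
    linarith
  simp only [h]
  have := (tendsto_const_nhds (x := (6 : ℝ))).div_atTop
    (tendsto_atTop_add_const_right atTop (2 : ℝ) tendsto_natCast_atTop_atTop)
  simpa using this.const_sub 4

theorem tendsto_catalan_add_div (k : ℕ) :
    Tendsto (fun n : ℕ => (catalan (n + k) / catalan n : ℝ)) atTop (𝓝 (4 ^ k)) := by
  have hC : ∀ n : ℕ, (catalan n : ℝ) ≠ 0 := fun n => by exact_mod_cast (catalan_pos n).ne'
  induction k with
  | zero => simp [hC]
  | succ k ih =>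
    rw [pow_succ']
    refine (((tendsto_add_atTop_iff_nat k).2 tendsto_catalan_succ_div).mul ih).congr fun n => ?_
    rw [div_mul_div_cancel₀ (hC _), add_assoc]

theorem tendsto_pathCount_div_catalan (d : ℕ) :
    Tendsto (fun n : ℕ => (pathCount (2 * n + d) d 0 / catalan n : ℝ)) atTop
      (𝓝 ((d + 1) * 2 ^ d)) := by
  have hC : ∀ n : ℕ, (catalan n : ℝ) ≠ 0 := fun n => by exact_mod_cast (catalan_pos n).ne'
  -- passing from `n` to `n + 1` inside a count multiplies the limit by `4`
  have shift : ∀ (f : ℕ → ℝ) (x : ℝ), Tendsto (fun n => f n / catalan n) atTop (𝓝 x) →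
      Tendsto (fun n => f (n + 1) / catalan n) atTop (𝓝 (x * 4)) := fun f x hf => by
    refine (((tendsto_add_atTop_iff_nat 1).2 hf).mul tendsto_catalan_succ_div).congr fun n => ?_
    rw [div_mul_div_cancel₀ (hC _)]
  induction d using Nat.twoStepInduction with
  | zero => simp [pathCount_two_mul_zero_zero, hC]
  | one =>
    have h := shift (fun n => (pathCount (2 * n) 0 0 : ℝ)) 1
      (by simp [pathCount_two_mul_zero_zero, hC])
    convert h using 2 with n
    · rw [show 2 * (n + 1) = 2 * n + 1 + 1 by ring, pathCount_succ_zero]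
    · norm_num
  | more d ih ih' =>
    have h := (shift (fun n => pathCount (2 * n + (d + 1)) (d + 1) 0) _ ih').sub
      (shift (fun n => pathCount (2 * n + d) d 0) _ ih)
    convert h using 2 with n
    · rw [← sub_div, show 2 * (n + 1) + (d + 1) = (2 * n + (d + 2)) + 1 by ring,
        pathCount_succ_succ, show 2 * (n + 1) + d = 2 * n + (d + 2) by ring]
      push_cast
      ring
    · push_cast
      ring

/-- The length of a path has the parity of the difference of the heights of its ends. -/
theorem pathCount_eq_zero_of_odd {m a b : ℕ} (h : Odd (m + a + b)) : pathCount m a b = 0 := by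
  rw [← card_dyckPaths, Finset.card_eq_zero, Finset.eq_empty_iff_forall_notMem]
  intro l hl
  obtain ⟨hlen, hc, -⟩ := mem_dyckPaths.1 hl
  have hsum : l.count .U + l.count .D = l.length := by
    clear hl hlen hc
    induction l with
    | nil => rfl
    | cons s l ih => cases s <;> simp <;> omega
  obtain ⟨j, hj⟩ := h
  omega

theorem tendsto_dyckHeightProb (r d : ℕ) :
    Tendsto (fun n : ℕ => dyckHeightProb n r d) atTop
      (𝓝 (pathCount r 0 d * (d + 1) / 2 ^ r)) := by
  have hC : ∀ n : ℕ, (catalan n : ℝ) ≠ 0 := fun n => by exact_mod_cast (catalan_pos n).ne'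
  -- the height of the `r`-th vertex has the parity of `r`; if `r + d = 2 * k`, then the second part
  -- of a path of semilength `n + k` has length `2 * n + d`
  rcases Nat.even_or_odd (r + 0 + d) with ⟨k, hk⟩ | h
  · rw [← tendsto_add_atTop_iff_nat k]
    have h := ((tendsto_pathCount_div_catalan d).div (tendsto_catalan_add_div k)
      (by positivity)).const_mul (pathCount r 0 d : ℝ)
    convert h using 2 with n
    · rw [dyckHeightProb_eq (k := 2 * n + d) (by omega)]
      simp only [Pi.div_apply]
      rw [div_div_div_cancel_right₀ (hC _)]
    · have : (4 : ℝ) ^ k = 2 ^ r * 2 ^ d := by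
        rw [← pow_add, show r + d = 2 * k by omega, pow_mul]; norm_num
      rw [this]
      field_simp
  · rw [pathCount_eq_zero_of_odd h, Nat.cast_zero, zero_mul, zero_div]
    refine tendsto_const_nhds.congr' ?_
    filter_upwards [eventually_ge_atTop r] with n hn
    rw [dyckHeightProb_eq (k := 2 * n - r) (by omega), pathCount_eq_zero_of_odd h]
    simp

/-! ### The generating function -/

namespace MvPowerSeries

/-- The Euler operator `X i * ∂/∂X i`, which multiplies each coefficient by its degree in `X i`. -/
def eulerDeriv {σ : Type*} (i : σ) (φ : MvPowerSeries σ ℝ) : MvPowerSeries σ ℝ :=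
  fun m => m i * coeff m φ

theorem coeff_eulerDeriv {σ : Type*} (i : σ) (φ : MvPowerSeries σ ℝ) (m : σ →₀ ℕ) :
    coeff m (eulerDeriv i φ) = m i * coeff m φ := rfl

theorem eulerDeriv_mul {σ : Type*} (i : σ) (φ ψ : MvPowerSeries σ ℝ) :
    eulerDeriv i (φ * ψ) = eulerDeriv i φ * ψ + φ * eulerDeriv i ψ := by
  classical
  ext m
  rw [map_add, coeff_eulerDeriv, coeff_mul, coeff_mul, coeff_mul, Finset.mul_sum,
    ← Finset.sum_add_distrib]
  refine Finset.sum_congr rfl fun p hp => ?_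
  rw [← Finset.HasAntidiagonal.mem_antidiagonal.1 hp, coeff_eulerDeriv, coeff_eulerDeriv,
    Finsupp.add_apply]
  push_cast
  ring

end MvPowerSeries

open MvPowerSeries in
/-- The series `√(1 - x ^ 2)` does not involve `y`. -/
theorem coeff_sqrtOneSubXSq_eq_zero {m : Fin 2 →₀ ℕ} (hm : m 1 ≠ 0) :
    coeff m sqrtOneSubXSq = 0 := by
  rw [sqrtOneSubXSq, PowerSeries.coeff_subst hasSubst_neg_X_sq]
  refine finsum_eq_zero_of_forall_eq_zero fun k => ?_
  rw [neg_pow, ← pow_mul, show (-1 : MvPowerSeries (Fin 2) ℝ) ^ k = C ((-1) ^ k) by simp,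
    coeff_C_mul, coeff_X_pow, if_neg, mul_zero, smul_zero]
  rintro rfl
  simp at hm

open MvPowerSeries in
theorem coeff_bivariateSeries (p : ℕ → ℕ → ℝ) (m : Fin 2 →₀ ℕ) :
    coeff m (bivariateSeries p) = p (m 0) (m 1) := rfl

namespace MvPowerSeries

theorem coeff_X_mul_of_eq_add {σ : Type*} {i : σ} {m n : σ →₀ ℕ} (φ : MvPowerSeries σ ℝ)
    (h : m = Finsupp.single i 1 + n) : coeff m (X i * φ) = coeff n φ := by
  rw [h, X, coeff_add_monomial_mul, one_mul]

theorem coeff_X_mul_of_eq_zero {σ : Type*} {i : σ} {m : σ →₀ ℕ} (φ : MvPowerSeries σ ℝ)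
    (h : m i = 0) : coeff m (X i * φ) = 0 := by
  classical
  rw [X, coeff_monomial_mul, if_neg]
  intro h'
  simpa [h] using h' i

end MvPowerSeries

/-- The exponent of the monomial `x ^ r * y ^ d`. -/
noncomputable def bidegree (r d : ℕ) : Fin 2 →₀ ℕ := Finsupp.single 0 r + Finsupp.single 1 d

theorem bidegree_apply_zero (r d : ℕ) : bidegree r d 0 = r := by simp [bidegree]

theorem bidegree_apply_one (r d : ℕ) : bidegree r d 1 = d := by simp [bidegree]

theorem bidegree_apply_apply (m : Fin 2 →₀ ℕ) : bidegree (m 0) (m 1) = m := by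
  ext i
  fin_cases i
  · exact bidegree_apply_zero _ _
  · exact bidegree_apply_one _ _

open MvPowerSeries in
theorem coeff_X_zero_mul (φ : MvPowerSeries (Fin 2) ℝ) (r d : ℕ) :
    coeff (bidegree (r + 1) d) (X 0 * φ) = coeff (bidegree r d) φ :=
  coeff_X_mul_of_eq_add φ (by rw [bidegree, bidegree, Finsupp.single_add]; abel)

open MvPowerSeries in
theorem coeff_X_one_mul (φ : MvPowerSeries (Fin 2) ℝ) (r d : ℕ) :
    coeff (bidegree r (d + 1)) (X 1 * φ) = coeff (bidegree r d) φ :=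
  coeff_X_mul_of_eq_add φ (by rw [bidegree, bidegree, Finsupp.single_add]; abel)

open MvPowerSeries in
theorem coeff_one_bidegree (r d : ℕ) :
    coeff (bidegree r d) (1 : MvPowerSeries (Fin 2) ℝ) = if r = 0 ∧ d = 0 then 1 else 0 := by
  classical
  rw [coeff_one]
  congr 1
  refine propext ⟨fun h => ?_, ?_⟩
  · exact ⟨by simpa [bidegree_apply_zero] using DFunLike.congr_fun h 0,
      by simpa [bidegree_apply_one] using DFunLike.congr_fun h 1⟩
  · rintro ⟨rfl, rfl⟩
    simp [bidegree]

open MvPowerSeries in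
/-- The quotient `2 / (1 + √(1 - x ^ 2) - x * y)` is the generating function of
`pathCount r d 0 / 2 ^ r`. -/
theorem coeff_eq_pathCount_div {φ : MvPowerSeries (Fin 2) ℝ}
    (h : φ * (1 + sqrtOneSubXSq - X 0 * X 1) = 2) (r d : ℕ) :
    coeff (bidegree r d) φ = pathCount r d 0 / 2 ^ r := by
  -- multiply by the conjugate `X 0 * X 1 - 1 + sqrtOneSubXSq` to remove the square root
  have key : X 0 * (C 2 * (X 1 * φ)) = X 0 * (X 0 * φ) + X 0 * (X 0 * (X 1 * (X 1 * φ)))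
      + X 0 * (X 1 * C 2) + C 2 * (sqrtOneSubXSq - 1) := by
    rw [show (C 2 : MvPowerSeries (Fin 2) ℝ) = 2 from map_ofNat C 2]
    linear_combination (X 0 * X 1 - 1 + sqrtOneSubXSq) * h - φ * sqrtOneSubXSq_sq
  have hs : ∀ r d, coeff (bidegree r (d + 1)) (C 2 * (sqrtOneSubXSq - 1)) = 0 := fun r d => by
    rw [coeff_C_mul, map_sub, coeff_sqrtOneSubXSq_eq_zero (by simp [bidegree_apply_one]),
      coeff_one_bidegree]
    simp
  have hC : ∀ r d, coeff (bidegree r d) (C 2 : MvPowerSeries (Fin 2) ℝ) =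
      if r = 0 ∧ d = 0 then 2 else 0 := fun r d => by
    rw [← mul_one (C 2), coeff_C_mul, coeff_one_bidegree]
    simp
  induction r generalizing d with
  | zero =>
    have h1 := congrArg (coeff (bidegree (0 + 1) (d + 1))) key
    rw [map_add, map_add, map_add, hs, coeff_X_zero_mul, coeff_X_zero_mul, coeff_X_zero_mul,
      coeff_X_zero_mul, coeff_C_mul, coeff_X_one_mul, coeff_X_one_mul, hC,
      coeff_X_mul_of_eq_zero _ (bidegree_apply_zero 0 _),
      coeff_X_mul_of_eq_zero _ (bidegree_apply_zero 0 _)] at h1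
    rw [pathCount_zero]
    by_cases hd : d = 0 <;> simp [hd] at h1 ⊢ <;> linarith
  | succ r ih =>
    have h1 := congrArg (coeff (bidegree (r + 1 + 1) (d + 1))) key
    rw [map_add, map_add, map_add, hs, coeff_X_zero_mul, coeff_X_zero_mul, coeff_X_zero_mul,
      coeff_X_zero_mul, coeff_C_mul, coeff_X_one_mul, coeff_X_zero_mul, coeff_X_one_mul,
      coeff_X_zero_mul, coeff_X_one_mul, hC, ih, if_neg (by simp)] at h1
    rw [pow_succ]
    rcases d with _ | d
    · rw [coeff_X_mul_of_eq_zero _ (bidegree_apply_one _ 0)] at h1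
      rw [pathCount_succ_zero]
      field_simp at h1 ⊢
      linarith
    · rw [coeff_X_one_mul, ih] at h1
      rw [pathCount_succ_succ]
      push_cast
      field_simp at h1 ⊢
      linarith

open MvPowerSeries in
theorem bivariateSeries_eq :
    bivariateSeries (fun r d => pathCount r 0 d * (d + 1) / 2 ^ r) =
      2 * (1 + (X 1) ^ 2 - 2 * X 0 * X 1 + (1 - (X 1) ^ 2) * sqrtOneSubXSq)⁻¹ := by
  set s := sqrtOneSubXSq
  have hs2 : s ^ 2 = 1 - X 0 ^ 2 := sqrtOneSubXSq_sq
  have hs0 : constantCoeff s = 1 := constantCoeff_sqrtOneSubXSq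
  set v : MvPowerSeries (Fin 2) ℝ := 1 + s - X 0 * X 1 with hv
  set φ : MvPowerSeries (Fin 2) ℝ := 2 * v⁻¹ with hφ
  have hv0 : constantCoeff v ≠ 0 := by simp [hv, hs0]
  have hφv : φ * v = 2 := by rw [hφ, mul_assoc, MvPowerSeries.inv_mul_cancel _ hv0, mul_one]
  -- the weights `d + 1` come from the operator `1 + y ∂/∂y`
  have hP : bivariateSeries (fun r d => pathCount r 0 d * (d + 1) / 2 ^ r) =
      φ + eulerDeriv 1 φ := by
    ext m
    rw [coeff_bivariateSeries, map_add, coeff_eulerDeriv, ← bidegree_apply_apply m,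
      coeff_eq_pathCount_div hφv, bidegree_apply_zero, bidegree_apply_one, pathCount_comm]
    ring
  have hEv : eulerDeriv 1 v = - (X 0 * X 1) := by
    ext m
    rw [coeff_eulerDeriv]
    by_cases hm : m 1 = 0
    · rw [hm, mul_comm (X 0), map_neg, coeff_X_mul_of_eq_zero _ hm]; simp
    · have h1 : coeff m (1 : MvPowerSeries (Fin 2) ℝ) = 0 := by
        rw [← bidegree_apply_apply m, coeff_one_bidegree, if_neg (by tauto)]
      rw [hv, map_sub, map_add, h1, coeff_sqrtOneSubXSq_eq_zero hm, ← bidegree_apply_apply m]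
      rw [bidegree_apply_one]
      obtain ⟨d, hd⟩ := Nat.exists_eq_succ_of_ne_zero hm
      rw [hd, mul_comm (X 0), map_neg, Nat.succ_eq_add_one, coeff_X_one_mul]
      rcases d with _ | d
      · simp
      · rw [X, coeff_monomial, if_neg]
        · simp
        · intro h
          simpa [bidegree] using DFunLike.congr_fun h 1
  have hE2 : eulerDeriv 1 (2 : MvPowerSeries (Fin 2) ℝ) = 0 := by
    ext m
    rw [coeff_eulerDeriv, ← bidegree_apply_apply m, ← map_ofNat C 2, ← mul_one (C _), coeff_C_mul,
      coeff_one_bidegree, bidegree_apply_one]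
    by_cases hm : m 1 = 0 <;> simp [hm]
  have hE : eulerDeriv 1 φ * v = φ * (X 0 * X 1) := by
    have := eulerDeriv_mul 1 φ v
    rw [hφv, hE2, hEv] at this
    linear_combination -this
  have hw0 : constantCoeff (1 + (X 1) ^ 2 - 2 * X 0 * X 1 + (1 - (X 1) ^ 2) * s) ≠ 0 := by
    simp [hs0]
  rw [MvPowerSeries.eq_mul_inv_iff_mul_eq hw0, hP]
  -- `v ^ 2` is `1 + s` times the denominator
  have hw : (1 + s) * (1 + (X 1) ^ 2 - 2 * X 0 * X 1 + (1 - (X 1) ^ 2) * s) = v ^ 2 := by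
    rw [hv]
    linear_combination (-(X 1) ^ 2) * hs2
  have h1s : (1 + s) ≠ 0 := fun h => by
    have := congrArg constantCoeff h
    rw [map_add, hs0] at this
    norm_num at this
  refine mul_left_cancel₀ h1s ?_
  linear_combination (φ + eulerDeriv 1 φ) * hw + (v + X 0 * X 1) * hφv + v * hE + 2 * hv

theorem mainTheorem2 :
    ∃ p : ℕ → ℕ → ℝ,
      (∀ r d : ℕ, Tendsto (fun n : ℕ => dyckHeightProb n r d) atTop (𝓝 (p r d))) ∧
      (∀ r : ℕ, HasSum (fun d : ℕ => p r d) 1) ∧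
      bivariateSeries p =
        2 * (1 + (MvPowerSeries.X 1) ^ 2 - 2 * MvPowerSeries.X 0 * MvPowerSeries.X 1
          + (1 - (MvPowerSeries.X 1) ^ 2) * sqrtOneSubXSq)⁻¹ := by
  refine ⟨fun r d => pathCount r 0 d * (d + 1) / 2 ^ r, tendsto_dyckHeightProb, fun r => ?_,
    bivariateSeries_eq⟩
  simpa using (hasSum_pathCount_mul r 0).div_const (2 ^ r)
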